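/- Let \(N \ge 2\) be an integer and let \(1 < p < \infty\). Write \(\mathbb{R}^N_+ = \{y \in \mathbb{R}^N : y_N > 0\}\) and identify its boundary \(\partial\mathbb{R}^N_+ = \mathbb{R}^{N-1}\times\{0\}\) with \(\mathbb{R}^{N-1}\), equipped with Lebesgue measure. There exists a constant \(C \in [0,\infty)\), depending only on \(N\) and \(p\), such that the following holds. If \(u \colon \mathbb{R}^N_+ \to \mathbb{R}\) and \(v \colon \partial\mathbb{R}^N_+ \to \mathbb{R}\) are (Lebesgue) measurable functions satisfying \[ L(u,v) := \liminf_{s \to 1^-}\, (1-s) \int_{\partial\mathbb{R}^N_+} \biggl(\int_{\mathbb{R}^N_+} \frac{|v(x)-u(y)|^p}{|x-y|^{N+sp}} \,\mathrm{d}y\biggr)\,\mathrm{d}x < \infty , \] then \(v \in \dot W^{1,p}(\partial\mathbb{R}^N_+)\), that is, \(v\) is locally integrable and has a weak gradient \(\mathrm{D}v \in L^p(\partial\mathbb{R}^N_+)\), and \[ \int_{\partial\mathbb{R}^N_+} |\mathrm{D}v|^p \le C\, L(u,v). \] -/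

import Mathlib

open Filter Topology MeasureTheory
open scoped ENNReal NNReal ContDiff

noncomputable section

/-- The open half-space of points of Euclidean space `ℝ^(n+1)` whose last coordinate is
positive. -/
def openHalfSpace (n : ℕ) : Set (EuclideanSpace ℝ (Fin (n + 1))) :=
  {y | 0 < y (Fin.last n)}

/-- The isometric parametrization `x ↦ (x, 0)` of the boundary hyperplane `{y | y_(n+1) = 0}` of
the half-space by `ℝ^n`. Functions and integrals on the boundary are written in this parameter,
with Lebesgue measure on `ℝ^n`. -/
def boundaryPoint {n : ℕ} (x : EuclideanSpace ℝ (Fin n)) : EuclideanSpace ℝ (Fin (n + 1)) :=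
  WithLp.toLp 2 (Fin.snoc (α := fun _ => ℝ) (fun i => x i) 0)

/-- The trace conjunction integral, with `N = n + 1`,
`∫_{∂ℝ^N_+} (∫_{ℝ^N_+} |v(x) - u(y)|^p / |x - y|^(N + s p) dy) dx`, as a value in `[0, ∞]`.
Only the values of `u` on the half-space matter. -/
def traceConjunctionIntegral (n : ℕ) (s p : ℝ) (u : EuclideanSpace ℝ (Fin (n + 1)) → ℝ)
    (v : EuclideanSpace ℝ (Fin n) → ℝ) : ℝ≥0∞ :=
  ∫⁻ x : EuclideanSpace ℝ (Fin n), ∫⁻ y in openHalfSpace n,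
    ENNReal.ofReal (|v x - u y| ^ p / dist (boundaryPoint x) y ^ (((n + 1 : ℕ) : ℝ) + s * p))

/-- The lower limit, as `s → 1` with `s < 1`, of `1 - s` times the trace conjunction integral. -/
def liminfTraceConjunction (n : ℕ) (p : ℝ) (u : EuclideanSpace ℝ (Fin (n + 1)) → ℝ)
    (v : EuclideanSpace ℝ (Fin n) → ℝ) : ℝ≥0∞ :=
  liminf (fun s : ℝ => ENNReal.ofReal (1 - s) * traceConjunctionIntegral n s p u v) (𝓝[<] 1)

/-- `G` is a weak gradient of `v` on `ℝ^n`: both are locally integrable and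
`∫ v ∂ᵢφ = -∫ Gᵢ φ` for every smooth compactly supported `φ` and every `i`. -/
structure HasWeakGradient {n : ℕ} (v : EuclideanSpace ℝ (Fin n) → ℝ)
    (G : EuclideanSpace ℝ (Fin n) → EuclideanSpace ℝ (Fin n)) : Prop where
  locallyIntegrable : LocallyIntegrable v volume
  locallyIntegrable_gradient : LocallyIntegrable G volume
  integral_eq : ∀ φ : EuclideanSpace ℝ (Fin n) → ℝ, ContDiff ℝ ∞ φ → HasCompactSupport φ →
    ∀ i : Fin n, ∫ x, v x * fderiv ℝ φ x (EuclideanSpace.single i 1) = -∫ x, G x i * φ x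

/-- Membership in the homogeneous Sobolev space `Ẇ^{1,p}(ℝ^n)`: `v` is weakly differentiable with
weak gradient in `L^p`. -/
def MemHomogeneousSobolev {n : ℕ} (p : ℝ) (v : EuclideanSpace ℝ (Fin n) → ℝ) : Prop :=
  ∃ G : EuclideanSpace ℝ (Fin n) → EuclideanSpace ℝ (Fin n),
    HasWeakGradient v G ∧ MemLp G (ENNReal.ofReal p) volume

end

/-! The values `v (x + ε h)` and `v x` can both be compared with the same interior value `u (x + ε
y)`. Averaging over `y` in a half-annulus bounds the `L^p` energy of the increment of `v` by `ε •
h`, for `|h| ≤ 1/4`, by the energy of `v(x) - u(y)` over `|x - y| ∼ ε`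
(`volume_mul_incrementEnergy_le`).

Cutting the trace integral into dyadic annuli bounds it below by a sum over `m` of these energies at
scale `2^(-m)`, with weights comparable to `2^(pm) q^m`, where `q = 2^(-p(1-s))`. Subadditivity of
increments shows that an increment at scale `2^(-k)` bounds the energies at all finer scales from
below, after normalization by `2^(pm)`. The geometric sum over `m ≥ k` is at least `q^k / (p(1-s))`,
and the factor `1 - s` cancels it. As `s → 1` with `k` fixed, `q^k → 1`, so the resulting bound `C L
2^(-kp)` on increments has a constant independent of `k` (`exists_incrementEnergy_le`).

Difference quotients of `v` are therefore bounded in `L^p`. Uniform convexity of `L^p` gives a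
strongly convergent sequence of their convex combinations, whose limit is the weak derivative
(`exists_weak_directional_derivative`). -/

/-! ### Uniform convexity and Cauchy selections -/

/-- Uniform convexity of `|·|^p` on the real line, in quantitative form. -/
theorem abs_sub_rpow_le_add_mul_convexity_gap {p : ℝ} (hp : 1 < p) {η : ℝ} (hη : 0 < η) :
    ∃ C : ℝ, 0 ≤ C ∧ ∀ a b : ℝ, |a - b| ^ p ≤ η * (|a| ^ p + |b| ^ p) +
      C * ((|a| ^ p + |b| ^ p) / 2 - |(a + b) / 2| ^ p) := by
  have hp0 : 0 < p := by linarith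
  have hgap : ∀ a b : ℝ, |(a + b) / 2| ^ p ≤ (|a| ^ p + |b| ^ p) / 2 ∧
      (a ≠ b → |(a + b) / 2| ^ p < (|a| ^ p + |b| ^ p) / 2) := by
    intro a b
    have key : |a| ≠ |b| → |(a + b) / 2| ^ p < (|a| ^ p + |b| ^ p) / 2 := by
      intro hab
      have h1 : (1 / 2 * |a| + 1 / 2 * |b|) ^ p < 1 / 2 * |a| ^ p + 1 / 2 * |b| ^ p :=
        (strictConvexOn_rpow hp).2 (abs_nonneg a) (abs_nonneg b) hab
          (by norm_num) (by norm_num) (by norm_num)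
      have h2 : |(a + b) / 2| ≤ 1 / 2 * |a| + 1 / 2 * |b| := by
        rw [abs_div, abs_two]; linarith [abs_add_le a b]
      have h3 := Real.rpow_le_rpow (abs_nonneg _) h2 hp0.le
      linarith
    by_cases hab : |a| = |b|
    · rcases abs_eq_abs.1 hab with h | h
      · subst h
        have : (a + a) / 2 = a := by ring
        simp [this]
      · subst h
        have : (-b + b) / 2 = 0 := by ring
        rw [this, abs_zero, Real.zero_rpow hp0.ne', abs_neg]
        refine ⟨by positivity, fun hne => ?_⟩
        have : b ≠ 0 := by rintro rfl; simp at hne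
        positivity
    · exact ⟨(key hab).le, fun _ => key hab⟩
  -- By homogeneity of degree `p` it suffices to work on the unit sphere, where the `η` term alone
  -- may fail to suffice. That part is compact and misses the diagonal, so strict convexity gives
  -- the gap a positive minimum `c`.
  set S : Set (ℝ × ℝ) := Metric.sphere 0 1 ∩
    {q | η * (|q.1| ^ p + |q.2| ^ p) ≤ |q.1 - q.2| ^ p} with hS
  have hSc : IsCompact S := by
    refine (isCompact_sphere _ _).inter_right (isClosed_le ?_ ?_) <;>
    fun_prop (disch := first | exact hp0.le | exact fun _ => Or.inr hp0)
  have hgc : Continuous fun q : ℝ × ℝ => (|q.1| ^ p + |q.2| ^ p) / 2 - |(q.1 + q.2) / 2| ^ p := by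
    fun_prop (disch := first | exact hp0.le | exact fun _ => Or.inr hp0)
  obtain ⟨c, hc, hcS⟩ : ∃ c > 0, ∀ q ∈ S,
      c ≤ (|q.1| ^ p + |q.2| ^ p) / 2 - |(q.1 + q.2) / 2| ^ p := by
    rcases S.eq_empty_or_nonempty with hE | hne
    · exact ⟨1, one_pos, by simp [hE]⟩
    · obtain ⟨q, hq, hmin⟩ := hSc.exists_isMinOn hne hgc.continuousOn
      refine ⟨_, ?_, fun r hr => hmin hr⟩
      have hne : q.1 ≠ q.2 := by
        intro h
        have h2 := hq.2
        simp only [Set.mem_ofPred_eq, h, sub_self, abs_zero, Real.zero_rpow hp0.ne'] at h2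
        have h0 : |q.2| ^ p ≤ 0 := by nlinarith
        have h0' : q.2 = 0 := by
          by_contra hq2
          have : 0 < |q.2| ^ p := by positivity
          linarith
        have : q = 0 := Prod.ext (h.trans h0') h0'
        have h1 := hq.1
        simp [this] at h1
      linarith [(hgap q.1 q.2).2 hne]
  -- With `r = max |a| |b|`, the left side is at most `(2r)^p`, and the gap is at least `c r^p`.
  refine ⟨2 ^ p / c, by positivity, fun a b => ?_⟩
  have hg0 := (hgap a b).1
  by_cases hab : |a - b| ^ p ≤ η * (|a| ^ p + |b| ^ p)
  · have : 0 ≤ 2 ^ p / c * ((|a| ^ p + |b| ^ p) / 2 - |(a + b) / 2| ^ p) :=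
      mul_nonneg (by positivity) (by linarith)
    linarith
  push Not at hab
  set r := ‖(a, b)‖ with hr
  have hr0 : 0 < r := by
    rw [hr, norm_pos_iff]
    intro h
    have ha : a = 0 := congrArg Prod.fst h
    have hb : b = 0 := congrArg Prod.snd h
    simp [ha, hb, Real.zero_rpow hp0.ne'] at hab
  have hsc : ∀ x : ℝ, |x| ^ p = r ^ p * |x / r| ^ p := by
    intro x
    rw [← Real.mul_rpow hr0.le (abs_nonneg _), abs_div, abs_of_pos hr0]
    congr 1; field_simp
  have hmem : ((a / r, b / r) : ℝ × ℝ) ∈ S := by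
    constructor
    · have : ((a / r, b / r) : ℝ × ℝ) = r⁻¹ • (a, b) := by
        ext <;> simp [div_eq_inv_mul]
      rw [mem_sphere_zero_iff_norm, this, norm_smul, ← hr, norm_inv, Real.norm_of_nonneg hr0.le,
        inv_mul_cancel₀ hr0.ne']
    · have h1 := hab.le
      rw [hsc a, hsc b, hsc (a - b), ← mul_add, mul_left_comm] at h1
      have := le_of_mul_le_mul_left h1 (by positivity)
      simpa [sub_div] using this
  have h1 := hcS _ hmem
  have h2 : c * r ^ p ≤ (|a| ^ p + |b| ^ p) / 2 - |(a + b) / 2| ^ p := by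
    rw [hsc a, hsc b, hsc ((a + b) / 2)]
    have : (a + b) / 2 / r = (a / r + b / r) / 2 := by ring
    rw [this]
    have h3 := mul_le_mul_of_nonneg_left h1 (show 0 ≤ r ^ p by positivity)
    simp only at h3
    nlinarith
  have h4 : |a - b| ^ p ≤ 2 ^ p * r ^ p := by
    rw [← Real.mul_rpow (by norm_num) hr0.le]
    refine Real.rpow_le_rpow (abs_nonneg _) ?_ hp0.le
    have ha : |a| ≤ r := norm_fst_le (a, b)
    have hb : |b| ≤ r := norm_snd_le (a, b)
    linarith [abs_sub a b]
  have h5 : 2 ^ p * r ^ p = 2 ^ p / c * (c * r ^ p) := by field_simp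
  have h6 : 2 ^ p / c * (c * r ^ p) ≤
      2 ^ p / c * ((|a| ^ p + |b| ^ p) / 2 - |(a + b) / 2| ^ p) := by gcongr
  have : 0 ≤ η * (|a| ^ p + |b| ^ p) := by positivity
  linarith

/-- In a uniformly convex normed space, a decreasing sequence of nonempty bounded convex sets
admits a Cauchy selection. -/
theorem exists_cauchySeq_mem_of_antitone_convex {X : Type*} [NormedAddCommGroup X]
    [NormedSpace ℝ X] {p : ℝ} (hp : 1 < p)
    (hX : ∀ η : ℝ, 0 < η → ∃ C : ℝ, 0 ≤ C ∧ ∀ f g : X, ‖f - g‖ ^ p ≤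
      η * (‖f‖ ^ p + ‖g‖ ^ p) + C * ((‖f‖ ^ p + ‖g‖ ^ p) / 2 - ‖(1 / 2 : ℝ) • (f + g)‖ ^ p))
    {K : ℕ → Set X} (hanti : Antitone K) (hconv : ∀ m, Convex ℝ (K m))
    (hne : ∀ m, (K m).Nonempty) {M : ℝ} (hM : ∀ f ∈ K 0, ‖f‖ ≤ M) :
    ∃ f : ℕ → X, (∀ m, f m ∈ K m) ∧ CauchySeq f := by
  have hp0 : 0 < p := by linarith
  -- Near-minimizers of the norm are selected. The infima `d m` increase to a finite limit, and the
  -- midpoint of `f l` and `f m` for `l ≥ m` lies in `K m`, so its norm cannot drop below `d m`.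
  -- This makes the convexity gap small.
  set d : ℕ → ℝ := fun m => sInf ((fun f : X => ‖f‖ ^ p) '' K m) with hd
  have hbdd : ∀ m, BddBelow ((fun f : X => ‖f‖ ^ p) '' K m) := fun m =>
    ⟨0, by rintro _ ⟨f, _, rfl⟩; positivity⟩
  have hdle : ∀ m, ∀ f ∈ K m, d m ≤ ‖f‖ ^ p := fun m f hf =>
    csInf_le (hbdd m) ⟨f, hf, rfl⟩
  have hdmono : Monotone d := fun m l hml =>
    csInf_le_csInf (hbdd m) ((hne l).image _) (Set.image_mono (hanti hml))
  have hfM : ∀ m, ∀ f ∈ K m, ‖f‖ ^ p ≤ M ^ p := fun m f hf =>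
    Real.rpow_le_rpow (norm_nonneg _) (hM f (hanti (Nat.zero_le m) hf)) hp0.le
  have hdM : ∀ m, d m ≤ M ^ p := fun m => by
    obtain ⟨f, hf⟩ := hne m
    exact (hdle m f hf).trans (hfM m f hf)
  have hsel : ∀ m : ℕ, ∃ f ∈ K m, ‖f‖ ^ p < d m + 1 / ((m : ℝ) + 1) := by
    intro m
    obtain ⟨_, ⟨f, hf, rfl⟩, hlt⟩ := exists_lt_of_csInf_lt ((hne m).image (fun f : X => ‖f‖ ^ p))
      (show d m < d m + 1 / ((m : ℝ) + 1) by linarith [Nat.one_div_pos_of_nat (α := ℝ) (n := m)])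
    exact ⟨f, hf, hlt⟩
  choose f hfK hfd using hsel
  refine ⟨f, hfK, ?_⟩
  have hdlim := tendsto_atTop_ciSup hdmono ⟨M ^ p, by rintro _ ⟨m, rfl⟩; exact hdM m⟩
  set D := ⨆ m, d m
  have hdD : ∀ m, d m ≤ D := fun m => le_ciSup ⟨M ^ p, by rintro _ ⟨m, rfl⟩; exact hdM m⟩ m
  rw [Metric.cauchySeq_iff']
  intro ε hε
  have hM0 : 0 ≤ M ^ p := le_trans (by positivity) (hfM 0 _ (hfK 0))
  -- Chosen so that the `η` term contributes at most `ε^p / 2`; the gap term will contribute less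
  -- than `ε^p / 4`.
  set η := ε ^ p / (4 * (M ^ p + 1)) with hη
  have hη0 : 0 < η := by positivity
  obtain ⟨C, hC0, hC⟩ := hX η hη0
  have hlim : Tendsto (fun m : ℕ => C * (D - d m + 1 / ((m : ℝ) + 1))) atTop (𝓝 0) := by
    have h := ((tendsto_const_nhds (x := D)).sub hdlim).add
      (tendsto_one_div_add_atTop_nhds_zero_nat (𝕜 := ℝ))
    simpa using h.const_mul C
  obtain ⟨m, hm⟩ := (hlim.eventually (gt_mem_nhds (show 0 < ε ^ p / 4 by positivity))).exists
  refine ⟨m, fun l hl => ?_⟩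
  have hmid : (1 / 2 : ℝ) • (f l + f m) ∈ K m := by
    rw [smul_add]
    exact hconv m (hanti hl (hfK l)) (hfK m) (by norm_num) (by norm_num) (by norm_num)
  have h1 := hdle m _ hmid
  have h2 := hC (f l) (f m)
  have h3 : (1 : ℝ) / ((l : ℝ) + 1) ≤ 1 / ((m : ℝ) + 1) := Nat.one_div_le_one_div hl
  have h4 : (‖f l‖ ^ p + ‖f m‖ ^ p) / 2 - ‖(1 / 2 : ℝ) • (f l + f m)‖ ^ p ≤
      D - d m + 1 / ((m : ℝ) + 1) := by
    have := hfd l; have := hfd m; have := hdD l; have := hdD m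
    linarith
  have h5 := mul_le_mul_of_nonneg_left h4 hC0
  have h6 : η * (‖f l‖ ^ p + ‖f m‖ ^ p) ≤ ε ^ p / 2 := by
    have : ‖f l‖ ^ p + ‖f m‖ ^ p ≤ 2 * (M ^ p + 1) := by
      linarith [hfM l _ (hfK l), hfM m _ (hfK m)]
    calc _ ≤ η * (2 * (M ^ p + 1)) := by gcongr
      _ = ε ^ p / 2 := by rw [hη]; field_simp; ring
  have h7 : ‖f l - f m‖ ^ p < ε ^ p := by
    have : 0 < ε ^ p := by positivity
    linarith
  rw [dist_eq_norm]
  exact lt_of_not_ge fun h => absurd (Real.rpow_le_rpow hε.le h hp0.le) (not_le.2 h7)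

theorem MeasureTheory.Lp.norm_rpow_eq_integral {α : Type*} {m : MeasurableSpace α} {μ : Measure α}
    {p : ℝ} (hp : 0 < p) (f : Lp ℝ (ENNReal.ofReal p) μ) :
    ‖f‖ ^ p = ∫ x, |f x| ^ p ∂μ := by
  have h0 : ENNReal.ofReal p ≠ 0 := by simpa using hp
  rw [Lp.norm_def, (Lp.memLp f).eLpNorm_eq_integral_rpow_norm h0 ENNReal.ofReal_ne_top,
    ENNReal.toReal_ofReal hp.le, ENNReal.toReal_ofReal (by positivity),
    Real.rpow_inv_rpow (by positivity) hp.ne']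
  rfl

theorem MeasureTheory.Lp.integrable_abs_rpow {α : Type*} {m : MeasurableSpace α} {μ : Measure α}
    {p : ℝ} (hp : 0 < p) (f : Lp ℝ (ENNReal.ofReal p) μ) :
    Integrable (fun x => |f x| ^ p) μ := by
  have h := (Lp.memLp f).integrable_norm_rpow (by simpa using hp) ENNReal.ofReal_ne_top
  rw [ENNReal.toReal_ofReal hp.le] at h
  exact h

/-- Uniform convexity of `L^p` for `1 < p < ∞`, in quantitative form. -/
theorem MeasureTheory.Lp.norm_sub_rpow_le_add_mul_convexity_gap {α : Type*}
    {m : MeasurableSpace α} {μ : Measure α} {p : ℝ} (hp : 1 < p) [Fact (1 ≤ ENNReal.ofReal p)]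
    (η : ℝ) (hη : 0 < η) : ∃ C : ℝ, 0 ≤ C ∧ ∀ f g : Lp ℝ (ENNReal.ofReal p) μ, ‖f - g‖ ^ p ≤
      η * (‖f‖ ^ p + ‖g‖ ^ p) + C * ((‖f‖ ^ p + ‖g‖ ^ p) / 2 - ‖(1 / 2 : ℝ) • (f + g)‖ ^ p) := by
  have hp0 : 0 < p := by linarith
  obtain ⟨C, hC0, hC⟩ := abs_sub_rpow_le_add_mul_convexity_gap hp hη
  refine ⟨C, hC0, fun f g => ?_⟩
  have hf := Lp.integrable_abs_rpow hp0 f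
  have hg := Lp.integrable_abs_rpow hp0 g
  have hm := Lp.integrable_abs_rpow hp0 ((1 / 2 : ℝ) • (f + g))
  have hs : Integrable (fun x => |f x| ^ p + |g x| ^ p) μ := hf.add hg
  have hr : Integrable (fun x => (|f x| ^ p + |g x| ^ p) / 2 -
      |((1 / 2 : ℝ) • (f + g) : Lp ℝ (ENNReal.ofReal p) μ) x| ^ p) μ := (hs.div_const 2).sub hm
  simp only [Lp.norm_rpow_eq_integral hp0]
  rw [← integral_add hf hg, ← integral_div, ← integral_sub (hs.div_const 2) hm,
    ← integral_const_mul, ← integral_const_mul,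
    ← integral_add (hs.const_mul η) (hr.const_mul C)]
  refine integral_mono_ae (Lp.integrable_abs_rpow hp0 _)
    ((hs.const_mul η).add (hr.const_mul C)) ?_
  filter_upwards [Lp.coeFn_sub f g, Lp.coeFn_smul (1 / 2 : ℝ) (f + g), Lp.coeFn_add f g]
    with x h1 h2 h3
  have := hC (f x) (g x)
  rw [div_eq_inv_mul (f x + g x), ← one_div] at this
  simp only [h1, h2, Pi.sub_apply, Pi.smul_apply, h3, Pi.add_apply, smul_eq_mul]
  exact this

/-! ### Difference quotients and weak derivatives -/

section DifferenceQuotients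

variable {E : Type*} [NormedAddCommGroup E] [NormedSpace ℝ E] [FiniteDimensional ℝ E]
  [MeasurableSpace E] [BorelSpace E] {μ : Measure E} [μ.IsAddHaarMeasure]

/-- Difference quotients of a locally integrable function converge to its distributional
derivative. -/
theorem tendsto_integral_differenceQuotient_mul {v : E → ℝ} (hv : LocallyIntegrable v μ) (e : E)
    {φ : E → ℝ} (hφ : ContDiff ℝ ∞ φ) (hφc : HasCompactSupport φ) :
    Tendsto (fun t : ℝ => ∫ x, t⁻¹ * (v (x + t • e) - v x) * φ x ∂μ) (𝓝[>] 0)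
      (𝓝 (-∫ x, v x * fderiv ℝ φ x e ∂μ)) := by
  obtain ⟨C, hC⟩ := ContDiff.lipschitzWith_of_hasCompactSupport hφc hφ (by simp)
  -- `K` contains the supports of `φ` and of its translates by `t • e` with `0 < t ≤ 1`. Truncating
  -- `v` to `K` leaves the integrals unchanged and makes it integrable.
  set K := Metric.cthickening ‖e‖ (tsupport φ) with hK
  have hKc : IsCompact K := IsCompact.cthickening hφc
  set w := K.indicator v with hw
  have hwi : Integrable w μ := (integrable_indicator_iff hKc.measurableSet).2
    (hv.integrableOn_isCompact hKc)
  have hsub : tsupport φ ⊆ K := Metric.self_subset_cthickening _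
  have hout : ∀ x ∉ K, ∀ t : ℝ, t ∈ Set.Ioc (0 : ℝ) 1 → φ (x + t • -e) = 0 := by
    intro x hx t ht
    rw [← Function.notMem_support]
    contrapose hx
    refine Metric.mem_cthickening_of_dist_le _ _ ‖e‖ (tsupport φ) (subset_tsupport _ hx) ?_
    simp only [dist_eq_norm, sub_add_cancel_left, norm_neg, norm_smul, Real.norm_eq_abs,
      abs_of_nonneg ht.1.le]
    exact mul_le_of_le_one_left (norm_nonneg e) ht.2
  have hφ0 : ∀ x ∉ K, φ x = 0 := fun x hx => by
    rw [← Function.notMem_support]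
    exact fun h => hx (hsub (subset_tsupport _ h))
  -- Translation invariance moves the difference quotient from `v` to `φ`, reversing the direction
  -- to `-e`.
  have hlim := hC.integral_inv_smul_sub_mul_tendsto_integral_lineDeriv_mul hwi (-e)
  have hlimval : ∫ x, lineDeriv ℝ φ x (-e) * w x ∂μ = -∫ x, v x * fderiv ℝ φ x e ∂μ := by
    rw [← integral_neg]
    congr 1
    ext x
    have hd : DifferentiableAt ℝ φ x := (hφ.differentiable (by simp)).differentiableAt
    rw [hd.lineDeriv_eq_fderiv, map_neg]
    by_cases hx : x ∈ K
    · rw [hw, Set.indicator_of_mem hx]; ring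
    · have : fderiv ℝ φ x = 0 := by
        by_contra h
        exact hx (hsub (tsupport_fderiv_subset ℝ (subset_tsupport _ h)))
      simp [this]
  rw [hlimval] at hlim
  refine hlim.congr' ?_
  filter_upwards [Ioc_mem_nhdsGT (zero_lt_one (α := ℝ))] with t ht
  have hvφ : Integrable (fun x => v x * φ x) μ := by
    simpa using hv.integrable_smul_right_of_hasCompactSupport hφ.continuous hφc
  have hshift : HasCompactSupport fun x => φ (x + t • -e) :=
    hφc.comp_homeomorph (Homeomorph.addRight (t • -e))
  have hvφs : Integrable (fun x => v x * φ (x + t • -e)) μ := by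
    simpa using hv.integrable_smul_right_of_hasCompactSupport
      (hφ.continuous.comp (continuous_id.add continuous_const)) hshift
  have htrans : ∫ x, v (x + t • e) * φ x ∂μ = ∫ x, v x * φ (x + t • -e) ∂μ := by
    simpa using integral_add_right_eq_self (μ := μ) (fun x => v x * φ (x + t • -e)) (t • e)
  have hvφt : Integrable (fun x => v (x + t • e) * φ x) μ := by
    have := hvφs.comp_add_right (t • e)
    simpa using this
  have h1 : ∫ x, t⁻¹ * (v (x + t • e) - v x) * φ x ∂μ =
      t⁻¹ * (∫ x, v (x + t • e) * φ x ∂μ - ∫ x, v x * φ x ∂μ) := by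
    rw [← integral_sub hvφt hvφ, ← integral_const_mul]
    congr 1; ext x; ring
  rw [h1, htrans, ← integral_sub hvφs hvφ, ← integral_const_mul]
  congr 1
  ext x
  by_cases hx : x ∈ K
  · rw [hw, Set.indicator_of_mem hx, smul_eq_mul]; ring
  · rw [hw, Set.indicator_of_notMem hx, hφ0 x hx, hout x hx t ht]; simp

/-- A locally integrable function whose difference quotients in the direction `e` are bounded in
`L^p` along a sequence of steps tending to `0` has a weak derivative in `L^p` in this direction. -/
theorem exists_weak_directional_derivative {p : ℝ} (hp : 1 < p) {v : E → ℝ}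
    (hvm : Measurable v) (hv : LocallyIntegrable v μ) (e : E) {A : ℝ≥0∞} (hA : A ≠ ⊤)
    {t : ℕ → ℝ} (ht0 : ∀ k, 0 < t k) (ht : Tendsto t atTop (𝓝 0))
    (h : ∀ k, ∫⁻ x, ‖v (x + t k • e) - v x‖ₑ ^ p ∂μ ≤ A * ENNReal.ofReal (t k) ^ p) :
    ∃ g : E → ℝ, MemLp g (ENNReal.ofReal p) μ ∧ ∫⁻ x, ‖g x‖ₑ ^ p ∂μ ≤ A ∧
      ∀ φ : E → ℝ, ContDiff ℝ ∞ φ → HasCompactSupport φ →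
        ∫ x, v x * fderiv ℝ φ x e ∂μ = -∫ x, g x * φ x ∂μ := by
  have hp0 : 0 < p := by linarith
  have hP0 : ENNReal.ofReal p ≠ 0 := by simpa using hp0
  have : Fact (1 ≤ ENNReal.ofReal p) := ⟨by simpa using ENNReal.ofReal_le_ofReal hp.le⟩
  set P := ENNReal.ofReal p with hP
  set Q := ENNReal.ofReal (p / (p - 1)) with hQ
  have hPQ : P.HolderConjugate Q := (Real.HolderConjugate.conjExponent hp).ennrealOfReal
  have hQ1 : 1 ≤ Q := by
    have : 1 ≤ p / (p - 1) := by rw [le_div_iff₀ (by linarith)]; linarith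
    rw [hQ, ← ENNReal.ofReal_one]; exact ENNReal.ofReal_le_ofReal this
  have : Fact (1 ≤ Q) := ⟨hQ1⟩
  set D : ℕ → E → ℝ := fun k x => (t k)⁻¹ * (v (x + t k • e) - v x) with hD
  have hDm : ∀ k, Measurable (D k) := fun k => by fun_prop
  have hDp : ∀ k, ∫⁻ x, ‖D k x‖ₑ ^ p ∂μ ≤ A := by
    intro k
    have hc0 : ENNReal.ofReal (t k) ≠ 0 := by simpa using ht0 k
    have h1 : ∀ x, ‖D k x‖ₑ ^ p = (ENNReal.ofReal (t k) ^ p)⁻¹ * ‖v (x + t k • e) - v x‖ₑ ^ p := by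
      intro x
      simp only [hD]
      rw [enorm_mul, ENNReal.mul_rpow_of_nonneg _ _ hp0.le, enorm_inv (ht0 k).ne',
        ENNReal.inv_rpow, Real.enorm_of_nonneg (ht0 k).le]
    simp_rw [h1]
    rw [lintegral_const_mul' _ _ (by simp [hp0, ht0 k])]
    have hcp0 : ENNReal.ofReal (t k) ^ p ≠ 0 := by simp [hp0, ht0 k]
    have hcpt : ENNReal.ofReal (t k) ^ p ≠ ⊤ := by finiteness
    calc _ ≤ (ENNReal.ofReal (t k) ^ p)⁻¹ * (A * ENNReal.ofReal (t k) ^ p) := by gcongr; exact h k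
      _ = A := by rw [mul_comm A, ← mul_assoc, ENNReal.inv_mul_cancel hcp0 hcpt, one_mul]
  have hnorm : ∀ g : E → ℝ, eLpNorm g P μ = (∫⁻ x, ‖g x‖ₑ ^ p ∂μ) ^ p⁻¹ := by
    intro g
    rw [eLpNorm_eq_lintegral_rpow_enorm_toReal hP0 ENNReal.ofReal_ne_top, hP,
      ENNReal.toReal_ofReal hp0.le, one_div]
  have hDe : ∀ k, eLpNorm (D k) P μ ≤ A ^ p⁻¹ := fun k => by
    rw [hnorm]; exact ENNReal.rpow_le_rpow (hDp k) (by positivity)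
  have hAp : A ^ p⁻¹ ≠ ⊤ := ENNReal.rpow_ne_top_of_nonneg (by positivity) hA
  have hDL : ∀ k, MemLp (D k) P μ := fun k =>
    ⟨(hDm k).aestronglyMeasurable, (hDe k).trans_lt hAp.lt_top⟩
  set F : ℕ → Lp ℝ P μ := fun k => (hDL k).toLp (D k) with hF
  have hFM : ∀ k, ‖F k‖ ≤ (A ^ p⁻¹).toReal := fun k => by
    rw [hF, Lp.norm_toLp]; exact ENNReal.toReal_mono hAp (hDe k)
  -- Convex hulls of the tails replace weak compactness: a selection from them converges in norm,
  -- and any continuous functional convergent along `F` keeps its limit along the selection, balls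
  -- being convex.
  set K : ℕ → Set (Lp ℝ P μ) := fun m => convexHull ℝ (F '' Set.Ici m) with hK
  have hKM : ∀ m, ∀ f ∈ K m, ‖f‖ ≤ (A ^ p⁻¹).toReal := by
    intro m f hf
    have hsub : K m ⊆ Metric.closedBall 0 (A ^ p⁻¹).toReal := by
      refine convexHull_min ?_ (convex_closedBall _ _)
      rintro _ ⟨k, _, rfl⟩
      simpa using hFM k
    simpa using hsub hf
  obtain ⟨f, hfK, hfC⟩ := exists_cauchySeq_mem_of_antitone_convex hp
    (Lp.norm_sub_rpow_le_add_mul_convexity_gap (μ := μ) hp) (K := K)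
    (fun m l hml => convexHull_mono (Set.image_mono (Set.Ici_subset_Ici.2 hml)))
    (fun m => convex_convexHull _ _)
    (fun m => ⟨F m, subset_convexHull _ _ ⟨m, Set.self_mem_Ici, rfl⟩⟩) (hKM 0)
  obtain ⟨g, hg⟩ := cauchySeq_tendsto_of_complete hfC
  have hgM : ‖g‖ ≤ (A ^ p⁻¹).toReal :=
    le_of_tendsto hg.norm (Eventually.of_forall fun m => hKM m _ (hfK m))
  refine ⟨g, Lp.memLp g, ?_, ?_⟩
  · have h1 : eLpNorm g P μ ≤ A ^ p⁻¹ := by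
      rw [Lp.norm_def] at hgM
      exact (ENNReal.toReal_le_toReal (Lp.eLpNorm_ne_top g) hAp).1 hgM
    rw [hnorm] at h1
    exact (ENNReal.rpow_le_rpow_iff (by positivity)).1 h1
  · intro φ hφ hφc
    have hφQ : MemLp φ Q μ := hφ.continuous.memLp_of_hasCompactSupport hφc
    set l : Lp ℝ P μ →L[ℝ] ℝ :=
      ((ContinuousLinearMap.mul ℝ ℝ).lpPairing μ P Q).flip (hφQ.toLp φ) with hl
    have hlval : ∀ f : Lp ℝ P μ, l f = ∫ x, f x * φ x ∂μ := by
      intro f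
      rw [hl, ContinuousLinearMap.flip_apply, ContinuousLinearMap.lpPairing_eq_integral]
      refine integral_congr_ae ?_
      filter_upwards [hφQ.coeFn_toLp] with x hx
      simp [hx]
    have hlF : Tendsto (fun k => l (F k)) atTop (𝓝 (-∫ x, v x * fderiv ℝ φ x e ∂μ)) := by
      have h1 := (tendsto_integral_differenceQuotient_mul hv e hφ hφc).comp
        (tendsto_nhdsWithin_iff.2 ⟨ht, Eventually.of_forall ht0⟩)
      refine h1.congr fun k => ?_
      rw [hlval]
      refine integral_congr_ae ?_
      filter_upwards [(hDL k).coeFn_toLp] with x hx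
      rw [hF, hx]
    have hlf : Tendsto (fun m => l (f m)) atTop (𝓝 (-∫ x, v x * fderiv ℝ φ x e ∂μ)) := by
      rw [Metric.tendsto_atTop]
      intro ε hε
      obtain ⟨m₀, hm₀⟩ := Metric.tendsto_atTop.1 hlF ε hε
      refine ⟨m₀, fun m hm => ?_⟩
      have hsub : K m ⊆ l ⁻¹' Metric.ball (-∫ x, v x * fderiv ℝ φ x e ∂μ) ε := by
        refine convexHull_min ?_ ((convex_ball _ _).linear_preimage l.toLinearMap)
        rintro _ ⟨k, hk, rfl⟩
        exact hm₀ k (hm.trans hk)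
      exact hsub (hfK m)
    have h2 := tendsto_nhds_unique hlf ((l.continuous.tendsto g).comp hg)
    rw [← hlval, ← h2, neg_neg]

end DifferenceQuotients

/-! ### The linear isometric embedding of the boundary -/

section BoundaryPoint

variable {n : ℕ}

theorem boundaryPoint_castSucc (x : EuclideanSpace ℝ (Fin n)) (i : Fin n) :
    boundaryPoint x i.castSucc = x i := by
  simp [boundaryPoint]

theorem boundaryPoint_last (x : EuclideanSpace ℝ (Fin n)) :
    boundaryPoint x (Fin.last n) = 0 := by
  simp [boundaryPoint]

theorem boundaryPoint_add (x y : EuclideanSpace ℝ (Fin n)) :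
    boundaryPoint (x + y) = boundaryPoint x + boundaryPoint y := by
  ext i
  refine Fin.lastCases ?_ (fun j => ?_) i <;>
    simp [boundaryPoint_last, boundaryPoint_castSucc]

theorem boundaryPoint_smul (c : ℝ) (x : EuclideanSpace ℝ (Fin n)) :
    boundaryPoint (c • x) = c • boundaryPoint x := by
  ext i
  refine Fin.lastCases ?_ (fun j => ?_) i <;>
    simp [boundaryPoint_last, boundaryPoint_castSucc]

theorem norm_boundaryPoint (x : EuclideanSpace ℝ (Fin n)) : ‖boundaryPoint x‖ = ‖x‖ := by
  simp [EuclideanSpace.norm_eq, Fin.sum_univ_castSucc, boundaryPoint_last, boundaryPoint_castSucc]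

@[fun_prop]
theorem continuous_boundaryPoint :
    Continuous (boundaryPoint : EuclideanSpace ℝ (Fin n) → EuclideanSpace ℝ (Fin (n + 1))) := by
  let f : EuclideanSpace ℝ (Fin n) →ₗ[ℝ] EuclideanSpace ℝ (Fin (n + 1)) :=
    ⟨⟨boundaryPoint, boundaryPoint_add⟩, boundaryPoint_smul⟩
  exact f.continuous_of_finiteDimensional

@[fun_prop]
theorem measurable_boundaryPoint :
    Measurable (boundaryPoint : EuclideanSpace ℝ (Fin n) → EuclideanSpace ℝ (Fin (n + 1))) :=
  continuous_boundaryPoint.measurable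

end BoundaryPoint

/-! ### Half-annuli and increments of the boundary function -/

noncomputable section

/-- The part of the dyadic annulus `1 ≤ |y| < 2` lying in the half-space. -/
def halfAnnulus (n : ℕ) : Set (EuclideanSpace ℝ (Fin (n + 1))) :=
  {y | 0 < y (Fin.last n) ∧ 1 ≤ ‖y‖ ∧ ‖y‖ < 2}

/-- An open half-annulus whose translates by boundary vectors of length at most `1 / 4` stay
inside `halfAnnulus n`. -/
def innerHalfAnnulus (n : ℕ) : Set (EuclideanSpace ℝ (Fin (n + 1))) :=
  {y | 0 < y (Fin.last n) ∧ 5 / 4 < ‖y‖ ∧ ‖y‖ < 7 / 4}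

/-- The `L^p` energy of the increment of `v` by the vector `h`. -/
def incrementEnergy {n : ℕ} (p : ℝ) (v : EuclideanSpace ℝ (Fin n) → ℝ)
    (h : EuclideanSpace ℝ (Fin n)) : ℝ≥0∞ :=
  ∫⁻ x, ‖v (x + h) - v x‖ₑ ^ p

/-- The `L^p` energy of `v(x) - u(y)` over `y - x` in the half-annulus of scale `ε`,
normalized to unit scale. -/
def annulusEnergy {n : ℕ} (p : ℝ) (u : EuclideanSpace ℝ (Fin (n + 1)) → ℝ)
    (v : EuclideanSpace ℝ (Fin n) → ℝ) (ε : ℝ) : ℝ≥0∞ :=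
  ∫⁻ y in halfAnnulus n, ∫⁻ x, ‖v x - u (boundaryPoint x + ε • y)‖ₑ ^ p

end

theorem EuclideanSpace.continuous_last {n : ℕ} :
    Continuous fun y : EuclideanSpace ℝ (Fin (n + 1)) => y (Fin.last n) := by
  fun_prop

theorem EuclideanSpace.measurable_last {n : ℕ} :
    Measurable fun y : EuclideanSpace ℝ (Fin (n + 1)) => y (Fin.last n) := by
  fun_prop

theorem measurableSet_halfAnnulus (n : ℕ) : MeasurableSet (halfAnnulus n) :=
  (measurableSet_lt measurable_const EuclideanSpace.measurable_last).inter
    ((measurableSet_le measurable_const measurable_norm).inter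
      (measurableSet_lt measurable_norm measurable_const))

theorem isOpen_innerHalfAnnulus (n : ℕ) : IsOpen (innerHalfAnnulus n) :=
  (isOpen_lt continuous_const EuclideanSpace.continuous_last).inter
    ((isOpen_lt continuous_const continuous_norm).inter (isOpen_lt continuous_norm continuous_const))

theorem volume_innerHalfAnnulus_ne_zero (n : ℕ) : volume (innerHalfAnnulus n) ≠ 0 := by
  refine ((isOpen_innerHalfAnnulus n).measure_pos _
    ⟨EuclideanSpace.single (Fin.last n) (3 / 2), ?_⟩).ne'
  simp only [innerHalfAnnulus, Set.mem_ofPred_eq, PiLp.norm_single]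
  norm_num

theorem volume_innerHalfAnnulus_ne_top (n : ℕ) : volume (innerHalfAnnulus n) ≠ ⊤ := by
  refine ne_top_of_le_ne_top (measure_ball_lt_top (x := 0) (r := 2)).ne
    (measure_mono fun y hy => ?_)
  have := hy.2.2
  rw [mem_ball_zero_iff]
  linarith

theorem sub_boundaryPoint_mem_halfAnnulus {n : ℕ} {y : EuclideanSpace ℝ (Fin (n + 1))}
    (hy : y ∈ innerHalfAnnulus n) {h : EuclideanSpace ℝ (Fin n)} (hh : ‖h‖ ≤ 1 / 4) :
    y - boundaryPoint h ∈ halfAnnulus n := by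
  obtain ⟨h1, h2, h3⟩ := hy
  have hb := norm_boundaryPoint h
  refine ⟨by simpa [boundaryPoint_last] using h1, ?_, ?_⟩
  · linarith [norm_sub_norm_le y (boundaryPoint h)]
  · linarith [norm_sub_le y (boundaryPoint h)]

theorem measurable_annulusEnergy_integrand {n : ℕ} {p : ℝ}
    {u : EuclideanSpace ℝ (Fin (n + 1)) → ℝ} {v : EuclideanSpace ℝ (Fin n) → ℝ}
    (hu : Measurable u) (hv : Measurable v) (ε : ℝ) :
    Measurable fun q : EuclideanSpace ℝ (Fin n) × EuclideanSpace ℝ (Fin (n + 1)) =>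
      ‖v q.1 - u (boundaryPoint q.1 + ε • q.2)‖ₑ ^ p := by
  fun_prop

/-- The triangle inequality passes through `u (boundaryPoint x + ε • y)`. Translating `x` by `ε • h`
turns the term with `v (x + ε • h)` into one with offset `y - boundaryPoint h`, still in the
half-annulus. Integrating over `y` yields the energy twice, hence `2 * 2^(p-1)`. -/
theorem volume_mul_incrementEnergy_le {n : ℕ} {p : ℝ} (hp : 1 < p)
    {u : EuclideanSpace ℝ (Fin (n + 1)) → ℝ} {v : EuclideanSpace ℝ (Fin n) → ℝ}
    (hu : Measurable u) (hv : Measurable v) (ε : ℝ) {h : EuclideanSpace ℝ (Fin n)}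
    (hh : ‖h‖ ≤ 1 / 4) :
    volume (innerHalfAnnulus n) * incrementEnergy p v (ε • h) ≤ 2 ^ p * annulusEnergy p u v ε := by
  have hp0 : 0 < p := by linarith
  set G : EuclideanSpace ℝ (Fin (n + 1)) → ℝ≥0∞ :=
    fun y => ∫⁻ x, ‖v x - u (boundaryPoint x + ε • y)‖ₑ ^ p with hG
  have hGm : Measurable G :=
    (measurable_annulusEnergy_integrand (p := p) hu hv ε).lintegral_prod_left'
  have hpt : ∀ y, incrementEnergy p v (ε • h) ≤
      2 ^ (p - 1) * (G (y - boundaryPoint h) + G y) := by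
    intro y
    have hshift : G (y - boundaryPoint h) =
        ∫⁻ x, ‖v (x + ε • h) - u (boundaryPoint x + ε • y)‖ₑ ^ p := by
      refine (lintegral_add_right_eq_self _ (ε • h)).symm.trans (lintegral_congr fun x => ?_)
      rw [boundaryPoint_add, boundaryPoint_smul, smul_sub]
      congr 4
      abel
    have hm1 : Measurable fun x => ‖v (x + ε • h) - u (boundaryPoint x + ε • y)‖ₑ ^ p := by
      fun_prop
    rw [hshift, hG, ← lintegral_add_left hm1, ← lintegral_const_mul' _ _ (by finiteness)]
    refine lintegral_mono fun x => ?_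
    refine le_trans ?_ (ENNReal.rpow_add_le_mul_rpow_add_rpow _ _ hp.le)
    refine ENNReal.rpow_le_rpow ?_ hp0.le
    rw [enorm_sub_rev (v x)]
    have : v (x + ε • h) - v x = (v (x + ε • h) - u (boundaryPoint x + ε • y)) +
        (u (boundaryPoint x + ε • y) - v x) := by ring
    rw [this]
    exact enorm_add_le _ _
  have hW := (isOpen_innerHalfAnnulus n).measurableSet
  have h1 : ∫⁻ y in innerHalfAnnulus n, G (y - boundaryPoint h) ≤ annulusEnergy p u v ε := by
    rw [annulusEnergy, ← lintegral_indicator hW, ← lintegral_indicator (measurableSet_halfAnnulus n),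
      ← lintegral_sub_right_eq_self ((halfAnnulus n).indicator _) (boundaryPoint h)]
    refine lintegral_mono fun y => ?_
    by_cases hy : y ∈ innerHalfAnnulus n
    · rw [Set.indicator_of_mem hy, Set.indicator_of_mem (sub_boundaryPoint_mem_halfAnnulus hy hh)]
    · rw [Set.indicator_of_notMem hy]; exact zero_le
  have h2 : ∫⁻ y in innerHalfAnnulus n, G y ≤ annulusEnergy p u v ε := by
    refine lintegral_mono_set fun y hy => ?_
    exact ⟨hy.1, by linarith [hy.2.1], by linarith [hy.2.2]⟩
  calc volume (innerHalfAnnulus n) * incrementEnergy p v (ε • h)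
      = ∫⁻ _ in innerHalfAnnulus n, incrementEnergy p v (ε • h) := by
        rw [setLIntegral_const, mul_comm]
    _ ≤ ∫⁻ y in innerHalfAnnulus n, 2 ^ (p - 1) * (G (y - boundaryPoint h) + G y) :=
        lintegral_mono fun y => hpt y
    _ ≤ 2 ^ (p - 1) * (annulusEnergy p u v ε + annulusEnergy p u v ε) := by
        rw [lintegral_const_mul' _ _ (by finiteness), lintegral_add_right _ hGm]
        gcongr
    _ = 2 ^ p * annulusEnergy p u v ε := by
        rw [← two_mul, ← mul_assoc]
        congr 1
        nth_rewrite 2 [← ENNReal.rpow_one 2]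
        rw [← ENNReal.rpow_add _ _ (by norm_num) (by norm_num)]
        congr 1; ring

/-- An increment by `2h` is the sum of two increments by `h`, which have equal energy by translation
invariance. -/
theorem incrementEnergy_two_smul_le {n : ℕ} {p : ℝ} (hp : 1 < p)
    {v : EuclideanSpace ℝ (Fin n) → ℝ} (hv : Measurable v) (h : EuclideanSpace ℝ (Fin n)) :
    incrementEnergy p v ((2 : ℝ) • h) ≤ 2 ^ p * incrementEnergy p v h := by
  have hp0 : 0 < p := by linarith
  have hm : Measurable fun x => ‖v (x + h) - v x‖ₑ ^ p := by fun_prop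
  have h1 : incrementEnergy p v h = ∫⁻ x, ‖v (x + h + h) - v (x + h)‖ₑ ^ p := by
    rw [incrementEnergy, ← lintegral_add_right_eq_self _ h]
  have h2 : (2 : ℝ≥0∞) ^ p = 2 ^ (p - 1) * 2 := by
    nth_rewrite 3 [← ENNReal.rpow_one 2]
    rw [← ENNReal.rpow_add _ _ (by norm_num) (by norm_num)]
    congr 1; ring
  rw [h2, mul_assoc, two_mul]
  nth_rewrite 2 [h1]
  rw [add_comm, incrementEnergy, incrementEnergy, ← lintegral_add_right _ hm,
    ← lintegral_const_mul' _ _ (by finiteness)]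
  refine lintegral_mono fun x => ?_
  refine le_trans ?_ (ENNReal.rpow_add_le_mul_rpow_add_rpow _ _ hp.le)
  refine ENNReal.rpow_le_rpow ?_ hp0.le
  have : v (x + (2 : ℝ) • h) - v x = (v (x + h + h) - v (x + h)) + (v (x + h) - v x) := by
    rw [two_smul, add_assoc]; ring
  rw [this]
  exact enorm_add_le _ _

/-- Energies normalized by the `p`-th power of the step cannot decrease under halving. One coarse
increment is thus felt at every finer scale of the dyadic sum. -/
theorem incrementEnergy_le_pow_mul {n : ℕ} {p : ℝ} (hp : 1 < p)
    {v : EuclideanSpace ℝ (Fin n) → ℝ} (hv : Measurable v) (j : ℕ)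
    (h : EuclideanSpace ℝ (Fin n)) :
    incrementEnergy p v h ≤ (2 ^ p) ^ j * incrementEnergy p v ((1 / 2 : ℝ) ^ j • h) := by
  induction j with
  | zero => simp
  | succ j ih =>
    refine ih.trans ?_
    have h1 := incrementEnergy_two_smul_le hp hv ((1 / 2 : ℝ) ^ (j + 1) • h)
    have h2 : (2 : ℝ) • (1 / 2 : ℝ) ^ (j + 1) • h = (1 / 2 : ℝ) ^ j • h := by
      rw [smul_smul]; congr 1; ring
    rw [h2] at h1
    rw [pow_succ, mul_assoc]
    gcongr

/-! ### Dyadic lower bound and passage to the lower limit -/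

/-- Affine change of variables in the Lebesgue integral on `ℝ^(n+1)`. -/
theorem lintegral_eq_mul_lintegral_add_smul {n : ℕ} {G : EuclideanSpace ℝ (Fin (n + 1)) → ℝ≥0∞}
    (hG : Measurable G) (a : EuclideanSpace ℝ (Fin (n + 1))) {ε : ℝ} (hε : 0 < ε) :
    ∫⁻ y, G y = ENNReal.ofReal (ε ^ (n + 1)) * ∫⁻ z, G (a + ε • z) := by
  have h1 : ∫⁻ z, G (a + ε • z) =
      ∫⁻ w, G (a + w) ∂(Measure.map (ε • ·) (volume : Measure (EuclideanSpace ℝ (Fin (n + 1))))) :=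
    
    (lintegral_map (f := fun w => G (a + w)) (hG.comp (measurable_const_add a))
      (measurable_const_smul ε)).symm
  rw [h1, Measure.map_addHaar_smul _ hε.ne', lintegral_smul_measure,
    lintegral_add_left_eq_self, finrank_euclideanSpace, Fintype.card_fin, smul_eq_mul, ← mul_assoc,
    ← ENNReal.ofReal_mul (by positivity), abs_of_pos (by positivity),
    mul_inv_cancel₀ (by positivity), ENNReal.ofReal_one, one_mul]

/-- The half-annuli `2^(-m) ≤ |x - y| < 2 * 2^(-m)` are disjoint. On each, the kernel is at least
its value at the outer radius, and rescaling to unit size produces the Jacobian in the numerator. -/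
theorem tsum_annulusEnergy_le_traceConjunctionIntegral {n : ℕ} {s p : ℝ} (hs : 0 < s) (hp : 1 < p)
    {u : EuclideanSpace ℝ (Fin (n + 1)) → ℝ} {v : EuclideanSpace ℝ (Fin n) → ℝ}
    (hu : Measurable u) (hv : Measurable v) :
    ∑' m : ℕ, ENNReal.ofReal (((1 / 2 : ℝ) ^ m) ^ (n + 1) /
        (2 * (1 / 2 : ℝ) ^ m) ^ (((n + 1 : ℕ) : ℝ) + s * p)) * annulusEnergy p u v ((1 / 2) ^ m) ≤
      traceConjunctionIntegral n s p u v := by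
  have hp0 : 0 < p := by linarith
  set a : ℝ := ((n + 1 : ℕ) : ℝ) + s * p with ha
  have ha0 : 0 < a := by positivity
  set ε : ℕ → ℝ := fun m => (1 / 2 : ℝ) ^ m with hε
  have hε0 : ∀ m, 0 < ε m := fun m => by positivity
  set R : EuclideanSpace ℝ (Fin n) → ℕ → Set (EuclideanSpace ℝ (Fin (n + 1))) := fun x m =>
    {y | 0 < y (Fin.last n) ∧ ε m ≤ dist (boundaryPoint x) y ∧ dist (boundaryPoint x) y < 2 * ε m}
    with hR
  have hRm : ∀ x m, MeasurableSet (R x m) := fun x m => by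
    have hdm : Measurable fun y : EuclideanSpace ℝ (Fin (n + 1)) => dist (boundaryPoint x) y := by
      fun_prop
    exact (measurableSet_lt measurable_const EuclideanSpace.measurable_last).inter
      ((measurableSet_le measurable_const hdm).inter (measurableSet_lt hdm measurable_const))
  have hlt : ∀ m l, m < l → 2 * ε l ≤ ε m := fun m l hml => by
    have : ε l ≤ ε (m + 1) := pow_le_pow_of_le_one (by norm_num) (by norm_num) hml
    have h2 : ε (m + 1) = ε m / 2 := by simp only [hε]; ring
    linarith
  have hRd : ∀ x, Pairwise (Function.onFun Disjoint (R x)) := by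
    intro x m l hml
    refine Set.disjoint_left.2 fun y hy hy' => ?_
    rcases lt_or_gt_of_ne hml with h | h
    · have := hlt _ _ h; linarith [hy.2.1, hy'.2.2]
    · have := hlt _ _ h; linarith [hy'.2.1, hy.2.2]
  have hRH : ∀ x, ⋃ m, R x m ⊆ openHalfSpace n := fun x =>
    Set.iUnion_subset fun m y hy => hy.1
  have hmem : ∀ x m z, boundaryPoint x + ε m • z ∈ R x m ↔ z ∈ halfAnnulus n := by
    intro x m z
    simp only [hR, halfAnnulus, Set.mem_ofPred_eq, PiLp.add_apply, boundaryPoint_last, zero_add,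
      PiLp.smul_apply, smul_eq_mul, dist_self_add_right, norm_smul, Real.norm_of_nonneg (hε0 m).le]
    rw [mul_pos_iff_of_pos_left (hε0 m), le_mul_iff_one_le_right (hε0 m), mul_comm 2,
      mul_lt_mul_iff_right₀ (hε0 m)]
  have hpiece : ∀ x m, ENNReal.ofReal (ε m ^ (n + 1) / (2 * ε m) ^ a) *
      (∫⁻ z in halfAnnulus n, ‖v x - u (boundaryPoint x + ε m • z)‖ₑ ^ p) ≤
      ∫⁻ y in R x m, ENNReal.ofReal (|v x - u y| ^ p / dist (boundaryPoint x) y ^ a) := by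
    intro x m
    have hfm : Measurable fun y => ENNReal.ofReal (|v x - u y| ^ p / dist (boundaryPoint x) y ^ a) := by
      fun_prop
    rw [← lintegral_indicator (hRm x m),
      lintegral_eq_mul_lintegral_add_smul (hfm.indicator (hRm x m)) (boundaryPoint x) (hε0 m),
      ← lintegral_indicator (measurableSet_halfAnnulus n), div_eq_mul_inv,
      ENNReal.ofReal_mul (by have := hε0 m; positivity), mul_assoc]
    gcongr
    rw [← lintegral_const_mul' _ _ ENNReal.ofReal_ne_top]
    refine lintegral_mono fun z => ?_
    by_cases hz : z ∈ halfAnnulus n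
    · rw [Set.indicator_of_mem hz, Set.indicator_of_mem ((hmem x m z).2 hz), ← Real.norm_eq_abs,
        div_eq_inv_mul, ENNReal.ofReal_mul (by positivity),
        ← ENNReal.ofReal_rpow_of_nonneg (norm_nonneg _) hp0.le, ofReal_norm]
      have hd : dist (boundaryPoint x) (boundaryPoint x + ε m • z) = ε m * ‖z‖ := by
        rw [dist_self_add_right, norm_smul, Real.norm_of_nonneg (hε0 m).le]
      gcongr
      · rw [hd]
        have := hε0 m
        have : 0 < ‖z‖ := by linarith [hz.2.1]
        positivity
      · rw [hd]
        nlinarith [hε0 m, hz.2.2]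
    · rw [Set.indicator_of_notMem hz]; simp
  have hint : ∀ m, annulusEnergy p u v (ε m) =
      ∫⁻ x, ∫⁻ z in halfAnnulus n, ‖v x - u (boundaryPoint x + ε m • z)‖ₑ ^ p := by
    intro m
    rw [annulusEnergy, lintegral_lintegral_swap]
    exact ((measurable_annulusEnergy_integrand hu hv (ε m)).comp measurable_swap).aemeasurable
  have hzm : ∀ m, Measurable fun x =>
      ∫⁻ z in halfAnnulus n, ‖v x - u (boundaryPoint x + ε m • z)‖ₑ ^ p := fun m =>
    (measurable_annulusEnergy_integrand (p := p) hu hv (ε m)).lintegral_prod_right'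
  calc ∑' m, ENNReal.ofReal (ε m ^ (n + 1) / (2 * ε m) ^ a) * annulusEnergy p u v (ε m)
      = ∫⁻ x, ∑' m, ENNReal.ofReal (ε m ^ (n + 1) / (2 * ε m) ^ a) *
          ∫⁻ z in halfAnnulus n, ‖v x - u (boundaryPoint x + ε m • z)‖ₑ ^ p := by
        rw [lintegral_tsum fun m => ((hzm m).const_mul _).aemeasurable]
        congr 1; ext m
        rw [lintegral_const_mul _ (hzm m), hint]
    _ ≤ traceConjunctionIntegral n s p u v := by
        refine lintegral_mono fun x => ?_
        refine (ENNReal.tsum_le_tsum fun m => hpiece x m).trans ?_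
        rw [← lintegral_iUnion (hRm x) (hRd x)]
        exact lintegral_mono_set (hRH x)

/-- A lower bound for the dyadic energies at all small scales bounds the lower limit from below. -/
theorem le_mul_liminfTraceConjunction {n : ℕ} {p : ℝ} (hp : 1 < p)
    {u : EuclideanSpace ℝ (Fin (n + 1)) → ℝ} {v : EuclideanSpace ℝ (Fin n) → ℝ}
    (hu : Measurable u) (hv : Measurable v) (k : ℕ) {B : ℝ≥0∞}
    (hB : ∀ j : ℕ, B ≤ ENNReal.ofReal ((2 ^ p) ^ (k + j)) * annulusEnergy p u v ((1 / 2) ^ (k + j))) :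
    B ≤ ENNReal.ofReal (2 ^ ((n + 1 : ℕ) + p) * (2 * p)) * liminfTraceConjunction n p u v := by
  have hp0 : 0 < p := by linarith
  -- The power of `2` comes from the outer radius in the kernel, `p` from `1 - q ≤ p * (1 - s)`, and
  -- the factor `2` from `q ^ k > 1 / 2`, valid for `s` near `1`.
  set c : ℝ := 2 ^ (((n + 1 : ℕ) : ℝ) + p) * (2 * p) with hc
  have hc0 : 0 < c := by positivity
  rw [← ENNReal.inv_mul_le_iff (by simpa using hc0) ENNReal.ofReal_ne_top,
    ← ENNReal.ofReal_inv_of_pos hc0]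
  have hq : Tendsto (fun s : ℝ => ((2 : ℝ) ^ (-(p * (1 - s)))) ^ k) (𝓝[<] 1) (𝓝 1) := by
    have h : Continuous fun s : ℝ => ((2 : ℝ) ^ (-(p * (1 - s)))) ^ k := by
      fun_prop (disch := norm_num)
    have h1 := h.tendsto 1
    simp only [sub_self, mul_zero, neg_zero, Real.rpow_zero, one_pow] at h1
    exact h1.mono_left nhdsWithin_le_nhds
  refine le_liminf_of_le (h := ?_)
  filter_upwards [hq.eventually (lt_mem_nhds (show (1 / 2 : ℝ) < 1 by norm_num)),
    Ioo_mem_nhdsLT (zero_lt_one (α := ℝ))] with s hsk hs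
  set q : ℝ := 2 ^ (-(p * (1 - s))) with hqdef
  have hx0 : 0 < p * (1 - s) := mul_pos hp0 (by linarith [hs.2])
  have hq0 : 0 < q := by positivity
  have hq1 : q < 1 := Real.rpow_lt_one_of_one_lt_of_neg (by norm_num) (by linarith)
  have hqx : 1 - q ≤ p * (1 - s) := by
    have h1 : q = Real.exp (-(Real.log 2 * (p * (1 - s)))) := by
      rw [hqdef, Real.rpow_def_of_pos (by norm_num)]; congr 1; ring
    have h2 := Real.add_one_le_exp (-(Real.log 2 * (p * (1 - s))))
    have h3 : Real.log 2 * (p * (1 - s)) ≤ 1 * (p * (1 - s)) := by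
      gcongr; linarith [Real.log_two_lt_d9]
    linarith
  -- The weight equals `2^(-(n+1+sp)) * 2^(spm)`, and `2^(spm) = q^m * 2^(pm)`; then `s ≤ 1` is used
  -- in the first factor.
  have hw : ∀ m : ℕ, ((2 : ℝ) ^ (((n + 1 : ℕ) : ℝ) + p))⁻¹ * q ^ m * (2 ^ p) ^ m ≤
      ((1 / 2 : ℝ) ^ m) ^ (n + 1) / (2 * (1 / 2 : ℝ) ^ m) ^ (((n + 1 : ℕ) : ℝ) + s * p) := by
    intro m
    have hε : (1 / 2 : ℝ) ^ m = 2 ^ (-(m : ℝ)) := by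
      rw [Real.rpow_neg (by norm_num), Real.rpow_natCast, one_div, inv_pow]
    have h2 : (2 : ℝ) * 2 ^ (-(m : ℝ)) = 2 ^ (1 + -(m : ℝ)) := by
      rw [Real.rpow_add (by norm_num), Real.rpow_one]
    rw [hε, h2, hqdef, ← Real.rpow_natCast, ← Real.rpow_natCast, ← Real.rpow_natCast,
      ← Real.rpow_mul (by norm_num), ← Real.rpow_mul (by norm_num), ← Real.rpow_mul (by norm_num),
      ← Real.rpow_mul (by norm_num), ← Real.rpow_neg (by norm_num), ← Real.rpow_add (by norm_num),
      ← Real.rpow_add (by norm_num), ← Real.rpow_sub (by norm_num)]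
    refine Real.rpow_le_rpow_of_exponent_le (by norm_num) ?_
    have : s * p ≤ p := by nlinarith [hs.2]
    nlinarith
  have hterm : ∀ j : ℕ, ENNReal.ofReal (((2 : ℝ) ^ (((n + 1 : ℕ) : ℝ) + p))⁻¹ * q ^ (k + j)) * B ≤
      ENNReal.ofReal (((1 / 2 : ℝ) ^ (k + j)) ^ (n + 1) /
        (2 * (1 / 2 : ℝ) ^ (k + j)) ^ (((n + 1 : ℕ) : ℝ) + s * p)) *
        annulusEnergy p u v ((1 / 2) ^ (k + j)) := by
    intro j
    calc _ ≤ ENNReal.ofReal (((2 : ℝ) ^ (((n + 1 : ℕ) : ℝ) + p))⁻¹ * q ^ (k + j)) *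
          (ENNReal.ofReal ((2 ^ p) ^ (k + j)) * annulusEnergy p u v ((1 / 2) ^ (k + j))) := by
          gcongr; exact hB j
      _ = ENNReal.ofReal (((2 : ℝ) ^ (((n + 1 : ℕ) : ℝ) + p))⁻¹ * q ^ (k + j) * (2 ^ p) ^ (k + j)) *
          annulusEnergy p u v ((1 / 2) ^ (k + j)) := by
          rw [← mul_assoc, ← ENNReal.ofReal_mul (by positivity)]
      _ ≤ _ := by
          gcongr
          exact hw (k + j)
  have hsum : ∑' j : ℕ, ENNReal.ofReal (((2 : ℝ) ^ (((n + 1 : ℕ) : ℝ) + p))⁻¹ * q ^ (k + j)) =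
      ENNReal.ofReal (((2 : ℝ) ^ (((n + 1 : ℕ) : ℝ) + p))⁻¹ * q ^ k * (1 - q)⁻¹) := by
    have hg := (hasSum_geometric_of_lt_one hq0.le hq1).mul_left
      (((2 : ℝ) ^ (((n + 1 : ℕ) : ℝ) + p))⁻¹ * q ^ k)
    rw [← hg.tsum_eq, ENNReal.ofReal_tsum_of_nonneg (fun j => by positivity) hg.summable]
    congr 1; ext j; rw [pow_add, mul_assoc]
  have hlow : c⁻¹ ≤ (1 - s) * (((2 : ℝ) ^ (((n + 1 : ℕ) : ℝ) + p))⁻¹ * q ^ k * (1 - q)⁻¹) := by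
    have h1 : (p * (1 - s))⁻¹ ≤ (1 - q)⁻¹ := inv_anti₀ (by linarith) hqx
    have hs1 : 0 < 1 - s := by linarith [hs.2]
    calc c⁻¹ = (1 - s) * (((2 : ℝ) ^ (((n + 1 : ℕ) : ℝ) + p))⁻¹ * (1 / 2) * (p * (1 - s))⁻¹) := by
          rw [hc]; field_simp
      _ ≤ _ := by gcongr
  have hJ := tsum_annulusEnergy_le_traceConjunctionIntegral (n := n) hs.1 hp hu hv
  calc ENNReal.ofReal c⁻¹ * B
      ≤ ENNReal.ofReal ((1 - s) * (((2 : ℝ) ^ (((n + 1 : ℕ) : ℝ) + p))⁻¹ * q ^ k * (1 - q)⁻¹)) * B := by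
        gcongr
    _ = ENNReal.ofReal (1 - s) * ∑' j : ℕ,
          ENNReal.ofReal (((2 : ℝ) ^ (((n + 1 : ℕ) : ℝ) + p))⁻¹ * q ^ (k + j)) * B := by
        rw [ENNReal.tsum_mul_right, hsum, ENNReal.ofReal_mul (by linarith [hs.2]), mul_assoc]
    _ ≤ ENNReal.ofReal (1 - s) * traceConjunctionIntegral n s p u v := by
        gcongr
        refine (ENNReal.tsum_le_tsum hterm).trans (le_trans ?_ hJ)
        exact ENNReal.tsum_comp_le_tsum_of_injective (add_right_injective k)
          fun m => ENNReal.ofReal (((1 / 2 : ℝ) ^ m) ^ (n + 1) /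
            (2 * (1 / 2 : ℝ) ^ m) ^ (((n + 1 : ℕ) : ℝ) + s * p)) * annulusEnergy p u v ((1 / 2) ^ m)

/-- Increments of `v` by small vectors are controlled by the lower limit of the trace conjunction
integrals. -/
theorem exists_incrementEnergy_le (n : ℕ) {p : ℝ} (hp : 1 < p) :
    ∃ C : ℝ≥0, ∀ (u : EuclideanSpace ℝ (Fin (n + 1)) → ℝ) (v : EuclideanSpace ℝ (Fin n) → ℝ),
      Measurable u → Measurable v → ∀ (k : ℕ) (h : EuclideanSpace ℝ (Fin n)),
        ‖h‖ ≤ (1 / 2) ^ k / 4 → incrementEnergy p v h ≤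
          C * liminfTraceConjunction n p u v * ENNReal.ofReal ((1 / 2) ^ k) ^ p := by
  have hp0 : 0 < p := by linarith
  set w := volume (innerHalfAnnulus n) with hw
  have hw0 : w ≠ 0 := volume_innerHalfAnnulus_ne_zero n
  have hwt : w ≠ ⊤ := volume_innerHalfAnnulus_ne_top n
  set c : ℝ≥0∞ := ENNReal.ofReal (2 ^ ((n + 1 : ℕ) + p) * (2 * p)) with hc
  have hCt : w⁻¹ * (2 ^ p * c) ≠ ⊤ := by
    refine ENNReal.mul_ne_top (ENNReal.inv_ne_top.2 hw0) (by finiteness)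
  refine ⟨(w⁻¹ * (2 ^ p * c)).toNNReal, fun u v hu hv k h hh => ?_⟩
  rw [ENNReal.coe_toNNReal hCt]
  have h2p : ENNReal.ofReal (2 ^ p) = 2 ^ p := by
    rw [← ENNReal.ofReal_rpow_of_nonneg (by norm_num) hp0.le]; simp
  have h2p0 : (2 : ℝ≥0∞) ^ p ≠ 0 := by simp [hp0]
  have h2pt : (2 : ℝ≥0∞) ^ p ≠ ⊤ := by finiteness
  have hB := le_mul_liminfTraceConjunction hp hu hv k
    (B := (2 ^ p)⁻¹ * ((2 ^ p) ^ k * (w * incrementEnergy p v h))) (fun j => by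
      rw [ENNReal.inv_mul_le_iff h2p0 h2pt, ENNReal.ofReal_pow (by positivity), h2p]
      -- The increment `2^(-j) h` is seen at scale `2^(-(k+j))` as the vector `2^k h`, whose length
      -- is at most `1/4` for every `j`.
      have hsplit : (1 / 2 : ℝ) ^ j • h = (1 / 2 : ℝ) ^ (k + j) • ((2 : ℝ) ^ k • h) := by
        rw [smul_smul, pow_add, mul_right_comm, ← mul_pow]; norm_num
      have hsmall : ‖(2 : ℝ) ^ k • h‖ ≤ 1 / 4 := by
        rw [norm_smul, norm_pow, Real.norm_two]
        calc (2 : ℝ) ^ k * ‖h‖ ≤ 2 ^ k * ((1 / 2) ^ k / 4) := by gcongr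
          _ = 1 / 4 := by rw [← mul_div_assoc, ← mul_pow]; norm_num
      have h1 := volume_mul_incrementEnergy_le hp hu hv ((1 / 2 : ℝ) ^ (k + j)) hsmall
      rw [← hsplit] at h1
      calc (2 ^ p) ^ k * (w * incrementEnergy p v h)
          ≤ (2 ^ p) ^ k * (w * ((2 ^ p) ^ j * incrementEnergy p v ((1 / 2 : ℝ) ^ j • h))) := by
            gcongr; exact incrementEnergy_le_pow_mul hp hv j h
        _ = (2 ^ p) ^ (k + j) * (w * incrementEnergy p v ((1 / 2 : ℝ) ^ j • h)) := by
            rw [pow_add]; ring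
        _ ≤ (2 ^ p) ^ (k + j) * (2 ^ p * annulusEnergy p u v ((1 / 2) ^ (k + j))) := by gcongr
        _ = _ := by ring)
  rw [ENNReal.inv_mul_le_iff h2p0 h2pt] at hB
  have hkp : ENNReal.ofReal ((1 / 2) ^ k) ^ p = ((2 ^ p) ^ k)⁻¹ := by
    rw [ENNReal.ofReal_pow (by norm_num), one_div, ENNReal.ofReal_inv_of_pos (by norm_num),
      ENNReal.ofReal_ofNat, ← ENNReal.inv_pow, ENNReal.inv_rpow, ← ENNReal.rpow_natCast,
      ← ENNReal.rpow_natCast, ← ENNReal.rpow_mul, ← ENNReal.rpow_mul, mul_comm p]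
  have h2k0 : ((2 : ℝ≥0∞) ^ p) ^ k ≠ 0 := pow_ne_zero _ h2p0
  have h2kt : ((2 : ℝ≥0∞) ^ p) ^ k ≠ ⊤ := ENNReal.pow_ne_top h2pt
  rw [hkp]
  calc incrementEnergy p v h
      = w⁻¹ * ((2 ^ p) ^ k)⁻¹ * ((2 ^ p) ^ k * (w * incrementEnergy p v h)) := by
        rw [mul_assoc, ENNReal.inv_mul_cancel_left h2k0 h2kt, ENNReal.inv_mul_cancel_left hw0 hwt]
    _ ≤ w⁻¹ * ((2 ^ p) ^ k)⁻¹ * (2 ^ p * (c * liminfTraceConjunction n p u v)) := by gcongr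
    _ = _ := by ring

/-! ### From increment bounds to a weak gradient -/

/-- A measurable function whose small increments have finite `L^p` energy is locally integrable. -/
theorem locallyIntegrable_of_incrementEnergy_le {n : ℕ} {p : ℝ} (hp : 1 < p)
    {v : EuclideanSpace ℝ (Fin n) → ℝ} (hv : Measurable v) {r : ℝ} (hr : 0 < r) {M : ℝ≥0∞}
    (hM : M ≠ ⊤) (h : ∀ h : EuclideanSpace ℝ (Fin n), ‖h‖ ≤ r → incrementEnergy p v h ≤ M) :
    LocallyIntegrable v volume := by
  have hp0 : 0 < p := by linarith
  -- Integrating over small `h` and exchanging integrals shows that `y ↦ v (x + y) - v x` is in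
  -- `L^p` of a ball for almost every `x`. Such centres are dense, so their balls cover the space.
  have hfin : ∫⁻ h in Metric.ball (0 : EuclideanSpace ℝ (Fin n)) r, incrementEnergy p v h ≠ ⊤ := by
    refine ne_top_of_le_ne_top (ENNReal.mul_ne_top hM
      (measure_ball_lt_top (μ := volume) (x := (0 : EuclideanSpace ℝ (Fin n))) (r := r)).ne) ?_
    rw [← setLIntegral_const]
    refine setLIntegral_mono measurable_const fun y hy => h y ?_
    exact (mem_ball_zero_iff.1 hy).le
  have hmeas : Measurable fun q : EuclideanSpace ℝ (Fin n) × EuclideanSpace ℝ (Fin n) =>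
      ‖v (q.2 + q.1) - v q.2‖ₑ ^ p := by fun_prop
  simp only [incrementEnergy] at hfin
  rw [lintegral_lintegral_swap hmeas.aemeasurable] at hfin
  have hae := ae_lt_top (Measurable.lintegral_prod_left'
    (f := fun q : EuclideanSpace ℝ (Fin n) × EuclideanSpace ℝ (Fin n) =>
      ‖v (q.2 + q.1) - v q.2‖ₑ ^ p) hmeas) hfin
  have hdense := Measure.dense_of_ae hae
  intro z
  obtain ⟨x, hx, hxz⟩ := Metric.dense_iff.1 hdense z r hr
  refine ⟨Metric.ball x r, ?_, ?_⟩
  · exact Metric.isOpen_ball.mem_nhds (by rwa [Metric.mem_ball_comm])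
  have h1 : MemLp (fun y => v (x + y) - v x) (ENNReal.ofReal p)
      (volume.restrict (Metric.ball 0 r)) := by
    refine ⟨(by fun_prop : Measurable fun y => v (x + y) - v x).aestronglyMeasurable, ?_⟩
    rw [eLpNorm_lt_top_iff_lintegral_rpow_enorm_lt_top (by simpa using hp0) ENNReal.ofReal_ne_top,
      ENNReal.toReal_ofReal hp0.le]
    exact hxz
  have : IsFiniteMeasure ((volume : Measure (EuclideanSpace ℝ (Fin n))).restrict
      (Metric.ball 0 r)) := ⟨by simpa using measure_ball_lt_top⟩
  have h2 : IntegrableOn (fun y => v (x + y)) (Metric.ball 0 r) := by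
    have := (h1.integrable (by simpa using ENNReal.ofReal_le_ofReal hp.le)).add
      (integrable_const (v x))
    refine this.congr (Eventually.of_forall fun y => ?_)
    simp
  have h3 := (measurePreserving_add_left volume x).integrableOn_comp_preimage
    (measurableEmbedding_addLeft x) (f := v) (s := Metric.ball x r)
  have hpre : (fun y => x + y) ⁻¹' Metric.ball x r = Metric.ball 0 r := by
    ext y
    simp
  rw [← h3, hpre]
  exact h2

/-- Allows passing to Borel representatives, needed for joint measurability after translations. -/
theorem liminfTraceConjunction_congr {n : ℕ} {p : ℝ}
    {u u' : EuclideanSpace ℝ (Fin (n + 1)) → ℝ} {v v' : EuclideanSpace ℝ (Fin n) → ℝ}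
    (hu : u =ᵐ[volume.restrict (openHalfSpace n)] u') (hv : v =ᵐ[volume] v') :
    liminfTraceConjunction n p u v = liminfTraceConjunction n p u' v' := by
  have h : ∀ s, traceConjunctionIntegral n s p u v = traceConjunctionIntegral n s p u' v' := by
    intro s
    refine lintegral_congr_ae ?_
    filter_upwards [hv] with x hx
    refine lintegral_congr_ae ?_
    filter_upwards [hu] with y hy
    rw [hx, hy]
  simp only [liminfTraceConjunction, h]

theorem HasWeakGradient.congr_left {n : ℕ} {v v' : EuclideanSpace ℝ (Fin n) → ℝ}
    {G : EuclideanSpace ℝ (Fin n) → EuclideanSpace ℝ (Fin n)} (h : HasWeakGradient v G)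
    (hv : v =ᵐ[volume] v') : HasWeakGradient v' G := by
  refine ⟨fun x => ?_, h.locallyIntegrable_gradient, fun φ hφ hφc i => ?_⟩
  · exact h.locallyIntegrable.congr hv x
  · rw [← h.integral_eq φ hφ hφc i]
    refine integral_congr_ae ?_
    filter_upwards [hv] with x hx
    rw [hx]

theorem MeasureTheory.LocallyIntegrable.euclideanSpace_apply {n : ℕ}
    {G : EuclideanSpace ℝ (Fin n) → EuclideanSpace ℝ (Fin n)} (h : LocallyIntegrable G volume)
    (i : Fin n) : LocallyIntegrable (fun x => G x i) volume := fun x => by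
  obtain ⟨s, hs, hi⟩ := h x
  exact ⟨s, hs, (EuclideanSpace.proj (𝕜 := ℝ) i).integrable_comp hi⟩

/-- Weak gradients are unique up to null sets. -/
theorem HasWeakGradient.ae_eq {n : ℕ} {v : EuclideanSpace ℝ (Fin n) → ℝ}
    {G G' : EuclideanSpace ℝ (Fin n) → EuclideanSpace ℝ (Fin n)} (h : HasWeakGradient v G)
    (h' : HasWeakGradient v G') : G =ᵐ[volume] G' := by
  have hi : ∀ i, ∀ᵐ x, G x i = G' x i := fun i => by
    refine ae_eq_of_integral_contDiff_smul_eq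
      (h.locallyIntegrable_gradient.euclideanSpace_apply i)
      (h'.locallyIntegrable_gradient.euclideanSpace_apply i) fun φ hφ hφc => ?_
    have h1 := h.integral_eq φ hφ hφc i
    rw [h'.integral_eq φ hφ hφc i, neg_inj] at h1
    simpa only [smul_eq_mul, mul_comm] using h1.symm
  filter_upwards [ae_all_iff.2 hi] with x hx
  ext i
  exact hx i

/-- A measurable function whose increments of size `t` have `L^p` energy of order `t^p` at dyadic
scales has a weak gradient in `L^p`. -/
theorem exists_hasWeakGradient_of_incrementEnergy_le {n : ℕ} {p : ℝ} (hp : 1 < p)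
    {v : EuclideanSpace ℝ (Fin n) → ℝ} (hv : Measurable v) {A : ℝ≥0∞} (hA : A ≠ ⊤)
    (h : ∀ (k : ℕ) (h : EuclideanSpace ℝ (Fin n)), ‖h‖ ≤ (1 / 2) ^ k / 4 →
      incrementEnergy p v h ≤ A * ENNReal.ofReal ((1 / 2) ^ k) ^ p) :
    ∃ G : EuclideanSpace ℝ (Fin n) → EuclideanSpace ℝ (Fin n),
      HasWeakGradient v G ∧ MemLp G (ENNReal.ofReal p) volume ∧
        ∫⁻ x, ‖G x‖ₑ ^ p ≤ (n : ℝ≥0∞) ^ (p - 1) * (n * (4 ^ p * A)) := by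
  have hp0 : 0 < p := by linarith
  have hvl : LocallyIntegrable v volume :=
    locallyIntegrable_of_incrementEnergy_le hp hv (r := 1 / 4) (by norm_num) hA
      fun y hy => by simpa using h 0 y (by simpa using hy)
  have hA' : 4 ^ p * A ≠ ⊤ := by finiteness
  have hpart : ∀ i : Fin n, ∃ g : EuclideanSpace ℝ (Fin n) → ℝ,
      MemLp g (ENNReal.ofReal p) volume ∧ ∫⁻ x, ‖g x‖ₑ ^ p ≤ 4 ^ p * A ∧
      ∀ φ : EuclideanSpace ℝ (Fin n) → ℝ, ContDiff ℝ ∞ φ → HasCompactSupport φ →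
        ∫ x, v x * fderiv ℝ φ x (EuclideanSpace.single i 1) = -∫ x, g x * φ x := by
    intro i
    have ht0 : ∀ k : ℕ, (0 : ℝ) < (1 / 2) ^ k / 4 := fun k => by positivity
    have ht : Tendsto (fun k : ℕ => (1 / 2 : ℝ) ^ k / 4) atTop (𝓝 0) := by
      simpa using (tendsto_pow_atTop_nhds_zero_of_lt_one (r := (1 / 2 : ℝ)) (by norm_num)
        (by norm_num)).div_const 4
    refine exists_weak_directional_derivative hp hv hvl (EuclideanSpace.single i (1 : ℝ)) hA' ht0 ht
      fun k => ?_
    refine (h k (((1 / 2 : ℝ) ^ k / 4) • EuclideanSpace.single i (1 : ℝ)) ?_).trans_eq ?_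
    · rw [norm_smul, PiLp.norm_single, norm_one, mul_one, Real.norm_of_nonneg (ht0 k).le]
    -- The factor `4^p` arises because the step is `2^(-k) / 4` while the bound is expressed through
    -- `2^(-k)`.
    · rw [mul_comm (4 ^ p) A, mul_assoc, ← ENNReal.mul_rpow_of_nonneg _ _ hp0.le]
      congr 2
      rw [← ENNReal.ofReal_ofNat 4, ← ENNReal.ofReal_mul (by norm_num)]
      congr 1
      ring
  choose g hgL hgA hgφ using hpart
  set G : EuclideanSpace ℝ (Fin n) → EuclideanSpace ℝ (Fin n) :=
    fun x => ∑ i, g i x • EuclideanSpace.single i (1 : ℝ) with hG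
  have hGi : ∀ x i, G x i = g i x := by
    intro x i
    simp [hG, Pi.single_apply]
  have hGL : MemLp G (ENNReal.ofReal p) volume := by
    refine memLp_finsetSum _ fun i _ => ?_
    exact (ContinuousLinearMap.toSpanSingleton ℝ (EuclideanSpace.single i (1 : ℝ))).comp_memLp'
      (hgL i)
  refine ⟨G, ⟨hvl, hGL.locallyIntegrable (by simpa using ENNReal.ofReal_le_ofReal hp.le), ?_⟩,
    hGL, ?_⟩
  · intro φ hφ hφc i
    simp only [hGi]
    exact hgφ i φ hφ hφc
  · have hpt : ∀ x, ‖G x‖ₑ ^ p ≤ (n : ℝ≥0∞) ^ (p - 1) * ∑ i, ‖g i x‖ₑ ^ p := by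
      intro x
      have h1 : ‖G x‖ₑ ≤ ∑ i, ‖g i x‖ₑ := by
        refine (enorm_sum_le _ _).trans (Finset.sum_le_sum fun i _ => ?_)
        rw [enorm_smul]
        simp [enorm_eq_nnnorm]
      refine (ENNReal.rpow_le_rpow h1 hp0.le).trans ?_
      simpa using ENNReal.rpow_sum_le_const_mul_sum_rpow Finset.univ (fun i => ‖g i x‖ₑ) hp.le
    calc ∫⁻ x, ‖G x‖ₑ ^ p ≤ ∫⁻ x, (n : ℝ≥0∞) ^ (p - 1) * ∑ i, ‖g i x‖ₑ ^ p := lintegral_mono hpt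
      _ = (n : ℝ≥0∞) ^ (p - 1) * ∑ i, ∫⁻ x, ‖g i x‖ₑ ^ p := by
        rw [lintegral_const_mul' _ _ (ENNReal.rpow_ne_top_of_nonneg (by linarith)
          (ENNReal.natCast_ne_top n)), lintegral_finsetSum']
        exact fun i _ => (hgL i).aestronglyMeasurable.enorm.pow_const p
      _ ≤ (n : ℝ≥0∞) ^ (p - 1) * ∑ _i : Fin n, 4 ^ p * A := by
        gcongr with i _
        exact hgA i
      _ = _ := by simp

theorem theorem8p3 (n : ℕ) (hn : 1 ≤ n) (p : ℝ) (hp : 1 < p) :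
    ∃ C : ℝ≥0, ∀ (u : EuclideanSpace ℝ (Fin (n + 1)) → ℝ) (v : EuclideanSpace ℝ (Fin n) → ℝ),
      AEMeasurable u (volume.restrict (openHalfSpace n)) → AEMeasurable v volume →
      liminfTraceConjunction n p u v < ⊤ →
        MemHomogeneousSobolev p v ∧
        ∀ G : EuclideanSpace ℝ (Fin n) → EuclideanSpace ℝ (Fin n), HasWeakGradient v G →
          (∫⁻ x, ‖G x‖ₑ ^ p) ≤ C * liminfTraceConjunction n p u v := by
  have hp0 : 0 < p := by linarith
  obtain ⟨C, hC⟩ := exists_incrementEnergy_le n hp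
  set D : ℝ≥0∞ := (n : ℝ≥0∞) ^ (p - 1) * (n * (4 ^ p * C)) with hD
  have hDt : D ≠ ⊤ := by
    refine ENNReal.mul_ne_top (ENNReal.rpow_ne_top_of_nonneg (by linarith)
      (ENNReal.natCast_ne_top n)) ?_
    finiteness
  refine ⟨D.toNNReal, fun u v hu hv hL => ?_⟩
  rw [ENNReal.coe_toNNReal hDt]
  have huu := hu.ae_eq_mk
  have hvv := hv.ae_eq_mk
  have hLL := liminfTraceConjunction_congr (p := p) huu hvv
  rw [hLL] at hL ⊢
  obtain ⟨G₀, hG₀, hG₀L, hG₀A⟩ := exists_hasWeakGradient_of_incrementEnergy_le hp hv.measurable_mk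
    (ENNReal.mul_ne_top ENNReal.coe_ne_top hL.ne)
    (fun k h hh => hC _ _ hu.measurable_mk hv.measurable_mk k h hh)
  have hG₀v := hG₀.congr_left hvv.symm
  refine ⟨⟨G₀, hG₀v, hG₀L⟩, fun G hG => ?_⟩
  -- Uniqueness of weak gradients carries the bound from the constructed `G₀` to an arbitrary `G`.
  have hGG : ∫⁻ x, ‖G x‖ₑ ^ p = ∫⁻ x, ‖G₀ x‖ₑ ^ p := by
    refine lintegral_congr_ae ?_
    filter_upwards [hG.ae_eq hG₀v] with x hx
    rw [hx]
  rw [hGG]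
  refine hG₀A.trans_eq ?_
  rw [hD]
  ring
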